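/- **Setting.** Let $n\ge 2$ and $\mathbb C_*=\mathbb C\setminus\{0\}$; let $m=(m_1,\dots,m_n)$ be a tuple of positive integers. Let $P=(P_1,\dots,P_n)$ be a positive regular polynomial $n$-tuple: every $P_j\in\mathbb C[z_1,\dots,z_n]$ has nonnegative coefficients and has the form $P_j=a_jz_j+\sum_{k=2}^{N_j}Q_{jk}$ with $a_j>0$ and $Q_{jk}$ a homogeneous polynomial of degree $k$. For $z\in\mathbb C\times\mathbb C_*^{n-1}$ put $\varphi(z)=(z_1/z_2,\dots,z_{n-1}/z_n,z_n)$, and write $u\diamond v=(u_1v_1,\dots,u_nv_n)$ for $u,v\in\mathbb C^n$ and $u^\alpha=\prod_j u_j^{\alpha_j}$ for $\alpha\in\mathbb Z_+^n$. The $P$-triangle is $$\triangle^n_P=\{z\in\mathbb C\times\mathbb C_*^{n-1}: P_j(\varphi(z)\diamond\overline{\varphi(z)})<1,\ j=1,\dots,n\}.$$ Let $\mathscr H^2_m(\triangle^n_P)$ be the reproducing kernel Hilbert space of functions on $\triangle^n_P$ with the (positive semi-definite) kernel $$\mathscr K_{P,m}(z,w)=\prod_{j=2}^n\frac1{z_j\overline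 w_j}\ \prod_{j=1}^n\frac1{\big(1-P_j(\varphi(z)\diamond\overline{\varphi(w)})\big)^{m_j}} .$$ Let $A_{P,m}(\alpha)\ge 0$, $\alpha\in\mathbb Z^n_+$, be the coefficients of the power series $\prod_{j=1}^n(1-P_j)^{-m_j}=\sum_\alpha A_{P,m}(\alpha)z^\alpha$, and for $z\in\mathbb C\times\mathbb C_*^{n-1}$ put $e_\alpha(z)=\sqrt{A_{P,m}(\alpha)}\,\varphi(z)^\alpha/\prod_{j=2}^nz_j$. For bounded operators $T_1,\dots,T_n$ and $w\in\mathbb C^n$ let $\ker(T-w)=\bigcap_j\ker(T_j-w_j)$ and $\sigma_p(T)=\{w\in\mathbb C^n:\ker(T-w)\ne\{0\}\}$. **Theorem.** The coordinate functions $z_1,\dots,z_n$ are multipliers of $\mathscr H^2_m(\triangle^n_P)$. Let $\mathscr M_z^*=(\mathscr M_{z_1}^*,\dots,\mathscr M_{z_n}^*)$ be the tuple of the adjoints of the (bounded) operators of multiplication by them. Then: 1. $\sigma_p(\mathscr M_z^*)\cap(\mathbb C\times\mathbb C_*^{n-1})=\triangle^n_P$. 2. For every $w\in\triangle^n_P$,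 $\ker(\mathscr M_z^*-\overline w)=\{\eta\,\mathscr K_{P,m}(\cdot,w):\eta\in\mathbb C\}$. 3. Let $w\in\mathbb C\times\mathbb C_*^{n-1}$ and $f\in\ker(\mathscr M_z^*-\overline w)$. Then there is $c\in\mathbb C$ with $f(z)=c\sum_{\alpha\in\mathbb Z^n_+}\overline{e_\alpha(w)}\,e_\alpha(z)$ for all $z\in\triangle^n_P$, where for $c\neq0$ the series converges unconditionally; and if $f\ne0$, then $\sum_{\alpha\in\mathbb Z_+^n}A_{P,m}(\alpha)\,|\varphi(w)^\alpha|^2<\infty$. -/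

import Mathlib

namespace GenHartogs

open scoped ComplexOrder ComplexConjugate InnerProductSpace Matrix

noncomputable section

/-- A positive regular polynomial `n`-tuple: every `P_j ∈ ℂ[z_1, …, z_n]` has nonnegative
coefficients (in the order of `ℂ`, i.e. they are nonnegative reals), and
`P_j = a_j z_j + ∑_{k=2}^{N_j} Q_{jk}` with `a_j > 0` and `Q_{jk}` homogeneous of degree `k`. -/
structure PosRegTuple (n : ℕ) where
  poly : Fin n → MvPolynomial (Fin n) ℂ
  coeff_nonneg : ∀ (j : Fin n) (α : Fin n →₀ ℕ), 0 ≤ (poly j).coeff α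
  expansion : ∀ j : Fin n, ∃ (a : ℝ) (N : ℕ) (Q : ℕ → MvPolynomial (Fin n) ℂ),
    0 < a ∧ (∀ k, (Q k).IsHomogeneous k) ∧
      poly j = MvPolynomial.C (a : ℂ) * MvPolynomial.X j + ∑ k ∈ Finset.Icc 2 N, Q k

/-- The set `ℂ × ℂ_*^{n-1}`: all coordinates but the first one are nonzero. -/
def puncturedSpace (n : ℕ) : Set (Fin n → ℂ) :=
  {z | ∀ j : Fin n, 0 < j.val → z j ≠ 0}

/-- The map `φ(z) = (z_1/z_2, …, z_{n-1}/z_n, z_n)`, an automorphism of `ℂ × ℂ_*^{n-1}`. -/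
def phi {n : ℕ} (z : Fin n → ℂ) : Fin n → ℂ := fun j =>
  if h : j.val + 1 < n then z j / z ⟨j.val + 1, h⟩ else z j

/-- The product `z_2 ⋯ z_n`. -/
def tailProd {n : ℕ} (z : Fin n → ℂ) : ℂ :=
  ∏ j ∈ Finset.univ.filter (fun j : Fin n => 0 < j.val), z j

/-- The monomial `z^α = z_1^{α_1} ⋯ z_n^{α_n}`. -/
def monom {n : ℕ} (z : Fin n → ℂ) (α : Fin n →₀ ℕ) : ℂ := ∏ j, z j ^ α j

/-- The value `P_j(φ(z) ⋄ conj φ(w))`, where `⋄` is the entrywise (Hadamard) product. -/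
def polyVal {n : ℕ} (P : PosRegTuple n) (j : Fin n) (z w : Fin n → ℂ) : ℂ :=
  MvPolynomial.eval (fun i => phi z i * conj (phi w i)) (P.poly j)

/-- The `P`-triangle (generalized Hartogs triangle)
`{z ∈ ℂ × ℂ_*^{n-1} : P_j(φ(z) ⋄ conj φ(z)) < 1, j = 1, …, n}`. The values are nonnegative reals,
and `<` is that of `ℂ` (equal imaginary parts and real parts in strict order). -/
def triangle {n : ℕ} (P : PosRegTuple n) : Set (Fin n → ℂ) :=
  {z | z ∈ puncturedSpace n ∧ ∀ j, polyVal P j z z < 1}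

/-- The scalar kernel
`K_{P,m}(z, w) = ∏_{j≥2} 1/(z_j conj w_j) * ∏_j 1/(1 - P_j(φ(z) ⋄ conj φ(w)))^{m_j}`. -/
def scalarKernel {n : ℕ} (P : PosRegTuple n) (m : Fin n → ℕ) (z w : Fin n → ℂ) : ℂ :=
  (∏ j ∈ Finset.univ.filter (fun j : Fin n => 0 < j.val), 1 / (z j * conj (w j))) *
    ∏ j, 1 / (1 - polyVal P j z w) ^ m j

/-- The kernel `K_{P,m}` on the `P`-triangle, with `ℂ` acting on `ℂ` by multiplication. -/
def opKernel {n : ℕ} (P : PosRegTuple n) (m : Fin n → ℕ) :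
    Matrix (triangle P) (triangle P) (ℂ →L[ℂ] ℂ) :=
  Matrix.of fun z w => scalarKernel P m z w • ContinuousLinearMap.id ℂ ℂ

/-- The power series `∏_j (1 - P_j)^{-m_j}` in `n` indeterminates. -/
def coeffSeries {n : ℕ} (P : PosRegTuple n) (m : Fin n → ℕ) : MvPowerSeries (Fin n) ℂ :=
  ∏ j, ((1 - (P.poly j : MvPowerSeries (Fin n) ℂ))⁻¹) ^ m j

/-- The coefficient function `A_{P,m}`: the coefficients of `∏_j (1 - P_j)^{-m_j}`, which are
nonnegative reals (`coeffSeries_nonneg`). -/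
def coeffFun {n : ℕ} (P : PosRegTuple n) (m : Fin n → ℕ) (α : Fin n →₀ ℕ) : ℝ :=
  (MvPowerSeries.coeff α (coeffSeries P m)).re

/-- The functions `e_α(z) = √(A_{P,m}(α)) φ(z)^α / (z_2 ⋯ z_n)`. -/
def basisFun {n : ℕ} (P : PosRegTuple n) (m : Fin n → ℕ) (α : Fin n →₀ ℕ) (z : Fin n → ℂ) : ℂ :=
  (Real.sqrt (coeffFun P m α) : ℂ) * monom (phi z) α / tailProd z

/-! ### Helper facts: the kernel is positive semidefinite -/

section psd

variable {X : Type*}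

theorem psd_rankOne (g : X → ℂ) :
    (Matrix.of fun z w => g z * conj (g w) : Matrix X X ℂ).PosSemidef := by
  refine ⟨?_, fun x => ?_⟩
  · ext i j
    simp [mul_comm]
  · have : (x.sum fun i xi => x.sum fun j xj =>
        star xi * (Matrix.of fun z w => g z * conj (g w) : Matrix X X ℂ) i j * xj)
        = star (x.sum fun j xj => conj (g j) * xj) * (x.sum fun j xj => conj (g j) * xj) := by
      simp only [Finsupp.sum, star_sum, Finset.sum_mul_sum, Matrix.of_apply]
      refine Finset.sum_congr rfl fun i _ => Finset.sum_congr rfl fun j _ => ?_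
      simp
      ring
    rw [this]
    exact star_mul_self_nonneg _

theorem psd_const {c : ℂ} (hc : 0 ≤ c) :
    (Matrix.of fun _ _ => c : Matrix X X ℂ).PosSemidef := by
  have h := (psd_rankOne (X := X) (fun _ => 1)).smul hc
  convert h using 1
  ext i j
  simp

theorem psd_mul {k l : X → X → ℂ} (hk : (Matrix.of k : Matrix X X ℂ).PosSemidef)
    (hl : (Matrix.of l : Matrix X X ℂ).PosSemidef) :
    (Matrix.of fun z w => k z w * l z w : Matrix X X ℂ).PosSemidef :=
  hk.hadamard hl

theorem psd_prod {ι : Type*} (s : Finset ι) {k : ι → X → X → ℂ}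
    (hk : ∀ i ∈ s, (Matrix.of (k i) : Matrix X X ℂ).PosSemidef) :
    (Matrix.of fun z w => ∏ i ∈ s, k i z w : Matrix X X ℂ).PosSemidef := by
  classical
  induction s using Finset.induction_on with
  | empty => simpa using psd_const (X := X) (c := 1) zero_le_one
  | insert a s ha ih =>
    simp only [Finset.prod_insert ha]
    exact psd_mul (hk a (Finset.mem_insert_self a s))
      (ih fun i hi => hk i (Finset.mem_insert_of_mem hi))

theorem psd_pow {k : X → X → ℂ} (hk : (Matrix.of k : Matrix X X ℂ).PosSemidef) (N : ℕ) :
    (Matrix.of fun z w => k z w ^ N : Matrix X X ℂ).PosSemidef := by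
  simpa using psd_prod (Finset.range N) (k := fun _ => k) (fun _ _ => hk)

theorem psd_sum {ι : Type*} (s : Finset ι) {k : ι → X → X → ℂ}
    (hk : ∀ i ∈ s, (Matrix.of (k i) : Matrix X X ℂ).PosSemidef) :
    (Matrix.of fun z w => ∑ i ∈ s, k i z w : Matrix X X ℂ).PosSemidef := by
  have h := Matrix.posSemidef_sum s hk
  convert h using 1
  ext i j
  simp [Matrix.sum_apply]

theorem psd_lim {k : ℕ → X → X → ℂ} {l : X → X → ℂ}
    (hk : ∀ N, (Matrix.of (k N) : Matrix X X ℂ).PosSemidef)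
    (hl : ∀ z w, Filter.Tendsto (fun N => k N z w) Filter.atTop (nhds (l z w))) :
    (Matrix.of l : Matrix X X ℂ).PosSemidef := by
  refine ⟨?_, fun x => ?_⟩
  · ext i j
    refine tendsto_nhds_unique ((hl j i).star) ((hl i j).congr fun N => ?_)
    exact ((hk N).1.apply i j).symm
  · refine ge_of_tendsto' (f := fun N => x.sum fun i xi => x.sum fun j xj =>
      star xi * (Matrix.of (k N) : Matrix X X ℂ) i j * xj) (x := Filter.atTop) ?_
      fun N => (hk N).2 x
    simp only [Finsupp.sum, Matrix.of_apply]
    exact tendsto_finsetSum _ fun i _ => tendsto_finsetSum _ fun j _ =>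
      ((hl i j).const_mul _).mul_const _

end psd

theorem polyVal_psd {n : ℕ} (P : PosRegTuple n) (j : Fin n) :
    (Matrix.of fun z w => polyVal P j z w : Matrix (Fin n → ℂ) (Fin n → ℂ) ℂ).PosSemidef := by
  simp only [polyVal, MvPolynomial.eval_eq]
  exact psd_sum _ fun α _ => psd_mul (psd_const (P.coeff_nonneg j α))
    (psd_prod _ fun i _ => psd_pow (psd_rankOne fun z : Fin n → ℂ => phi z i) _)

theorem polyVal_norm_lt {n : ℕ} (P : PosRegTuple n) (j : Fin n) {z w : Fin n → ℂ}
    (hz : z ∈ triangle P) (hw : w ∈ triangle P) : ‖polyVal P j z w‖ < 1 := by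
  have hp := polyVal_psd P j
  have h2 := (hp.submatrix (![z, w] : Fin 2 → Fin n → ℂ)).det_nonneg
  have hherm : polyVal P j w z = conj (polyVal P j z w) := (hp.1.apply w z).symm
  rw [Matrix.det_fin_two] at h2
  simp only [Matrix.submatrix_apply, Matrix.of_apply, Matrix.cons_val_zero, Matrix.cons_val_one]
    at h2
  rw [hherm, Complex.mul_conj, sub_nonneg] at h2
  have hz0 : 0 ≤ polyVal P j z z := hp.diag_nonneg (i := z)
  have hz1 := hz.2 j
  have hw0 : 0 ≤ polyVal P j w w := hp.diag_nonneg (i := w)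
  have hw1 := hw.2 j
  have h3 : polyVal P j z z * polyVal P j w w < 1 := by
    rcases hw0.eq_or_lt with h | h
    · rw [← h]; simp
    · calc _ < 1 * polyVal P j w w := mul_lt_mul_of_pos_right hz1 h
        _ < 1 := by rwa [one_mul]
  have h4 : Complex.normSq (polyVal P j z w) < 1 := by exact_mod_cast h2.trans_lt h3
  rw [Complex.normSq_eq_norm_sq] at h4
  nlinarith [norm_nonneg (polyVal P j z w)]

theorem scalarKernel_psd {n : ℕ} (P : PosRegTuple n) (m : Fin n → ℕ) :
    (Matrix.of fun z w => scalarKernel P m z w : Matrix (triangle P) (triangle P) ℂ).PosSemidef := by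
  simp only [scalarKernel]
  refine psd_mul (psd_prod _ fun i _ => ?_) (psd_prod _ fun j _ => ?_)
  · convert psd_rankOne (fun z : triangle P => 1 / z.1 i) using 4
    simp [mul_comm]
  · have hsub : (Matrix.of fun z w => polyVal P j z w :
        Matrix (triangle P) (triangle P) ℂ).PosSemidef :=
      (polyVal_psd P j).submatrix (Subtype.val : triangle P → Fin n → ℂ)
    simp only [one_div, ← inv_pow]
    refine psd_pow (psd_lim
      (k := fun N (z w : triangle P) => ∑ k ∈ Finset.range N, polyVal P j z w ^ k)
      (fun N => psd_sum _ fun k _ => psd_pow hsub k) fun z w => ?_) _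
    exact (hasSum_geometric_of_norm_lt_one (polyVal_norm_lt P j z.2 w.2)).tendsto_sum_nat

instance opKernel_psd {n : ℕ} (P : PosRegTuple n) (m : Fin n → ℕ) :
    Fact (opKernel P m).PosSemidef := by
  have key := (RKHS.posSemidef_tfae (𝕜 := ℂ) (K := opKernel P m)).out 0 2
  refine ⟨key.mpr ⟨?_, fun v => ?_⟩⟩
  · ext1 z w
    have h := (scalarKernel_psd P m).1.apply z w
    simp only [Matrix.of_apply] at h
    rw [Matrix.conjTranspose_apply]
    simp only [opKernel, Matrix.of_apply]
    rw [star_smul, h]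
    congr 1
    exact star_one (ℂ →L[ℂ] ℂ)
  · have h := (scalarKernel_psd P m).2 v
    have h2 := (Complex.le_def.mp h).1
    simp only [Complex.zero_re] at h2
    refine h2.trans_eq ?_
    simp only [Finsupp.sum, RCLike.re_eq_complex_re, Matrix.of_apply]
    congr 1
    refine Finset.sum_congr rfl fun z _ => Finset.sum_congr rfl fun w _ => ?_
    have hh := (scalarKernel_psd P m).1.apply w z
    simp only [Matrix.of_apply] at hh
    simp only [opKernel, Matrix.of_apply, _root_.smul_apply,
      ContinuousLinearMap.id_apply, smul_eq_mul, RCLike.inner_apply, map_mul]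
    have h3 : conj (scalarKernel P m w z) = scalarKernel P m z w := by
      rw [← hh]; simp
    rw [h3]
    simp only [RCLike.star_def]
    ring

/-! ### Helper fact: the coefficient function is nonnegative -/

theorem constantCoeff_poly {n : ℕ} (P : PosRegTuple n) (j : Fin n) :
    MvPolynomial.constantCoeff (P.poly j) = 0 := by
  obtain ⟨a, N, Q, -, hQ, h⟩ := P.expansion j
  rw [h, map_add, map_mul, MvPolynomial.constantCoeff_X, mul_zero, zero_add, map_sum]
  refine Finset.sum_eq_zero fun k hk => ?_
  rw [MvPolynomial.constantCoeff_eq]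
  refine (hQ k).coeff_eq_zero ?_
  simp only [Finset.mem_Icc] at hk
  simp
  omega

theorem inv_one_sub_nonneg {n : ℕ} (P : PosRegTuple n) (j : Fin n) (α : Fin n →₀ ℕ) :
    0 ≤ MvPowerSeries.coeff α (1 - (P.poly j : MvPowerSeries (Fin n) ℂ))⁻¹ := by
  classical
  have h0 : MvPowerSeries.constantCoeff (1 - (P.poly j : MvPowerSeries (Fin n) ℂ)) = 1 := by
    have h := constantCoeff_poly P j
    rw [MvPolynomial.constantCoeff_eq] at h
    rw [map_sub, ← MvPowerSeries.coeff_zero_eq_constantCoeff_apply,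
      ← MvPowerSeries.coeff_zero_eq_constantCoeff_apply, MvPolynomial.coeff_coe, h]
    simp
  induction α using WellFoundedLT.induction with
  | ind α ih =>
    rw [MvPowerSeries.coeff_inv, h0]
    split_ifs with h
    · simp
    · rw [inv_one, neg_one_mul, ← Finset.sum_neg_distrib]
      refine Finset.sum_nonneg fun x hx => ?_
      split_ifs with hlt
      · have hx1 : x.1 ≠ 0 := by
          rintro h1
          rw [Finset.HasAntidiagonal.mem_antidiagonal, h1, zero_add] at hx
          exact hlt.ne hx
        rw [map_sub, MvPowerSeries.coeff_one, if_neg hx1, zero_sub, MvPolynomial.coeff_coe,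
          neg_mul, neg_neg]
        exact mul_nonneg (P.coeff_nonneg j _) (ih _ hlt)
      · simp

theorem coeff_mul_nonneg {n : ℕ} {f g : MvPowerSeries (Fin n) ℂ}
    (hf : ∀ α, 0 ≤ MvPowerSeries.coeff α f) (hg : ∀ α, 0 ≤ MvPowerSeries.coeff α g)
    (α : Fin n →₀ ℕ) : 0 ≤ MvPowerSeries.coeff α (f * g) := by
  classical
  rw [MvPowerSeries.coeff_mul]
  exact Finset.sum_nonneg fun x _ => mul_nonneg (hf _) (hg _)

theorem coeff_one_nonneg {n : ℕ} (α : Fin n →₀ ℕ) :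
    0 ≤ MvPowerSeries.coeff α (1 : MvPowerSeries (Fin n) ℂ) := by
  classical
  rw [MvPowerSeries.coeff_one]
  split_ifs <;> simp

theorem coeffSeries_nonneg {n : ℕ} (P : PosRegTuple n) (m : Fin n → ℕ) (α : Fin n →₀ ℕ) :
    0 ≤ MvPowerSeries.coeff α (coeffSeries P m) := by
  have h := Finset.prod_induction (s := Finset.univ)
    (fun j => ((1 - (P.poly j : MvPowerSeries (Fin n) ℂ))⁻¹) ^ m j)
    (fun f => ∀ α, 0 ≤ MvPowerSeries.coeff α f)
    (fun _ _ hf hg => coeff_mul_nonneg hf hg) coeff_one_nonneg fun j _ => ?_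
  · exact h α
  · intro α
    induction m j generalizing α with
    | zero => simpa using coeff_one_nonneg α
    | succ k ih =>
      rw [pow_succ]
      exact coeff_mul_nonneg ih (inv_one_sub_nonneg P j) α

/-! ### The Hardy-Hilbert space and the multiplication operators -/

/-- The Hardy-Hilbert space `H²_m(△ⁿ_P)`: the reproducing kernel Hilbert space of functions on the
`P`-triangle with kernel `K_{P,m}`. -/
abbrev HardySpace {n : ℕ} (P : PosRegTuple n) (m : Fin n → ℕ) : Type :=
  RKHS.OfKernel (opKernel P m)

/-- The kernel function `K_{P,m}(·, w)` as an element of the space. -/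
def kernelFun {n : ℕ} (P : PosRegTuple n) (m : Fin n → ℕ) (w : triangle P) : HardySpace P m :=
  RKHS.kerFun (HardySpace P m) w 1

theorem kernelFun_apply {n : ℕ} (P : PosRegTuple n) (m : Fin n → ℕ) (z w : triangle P) :
    kernelFun P m w z = scalarKernel P m z w := by
  rw [kernelFun, RKHS.kerFun_apply, RKHS.OfKernel.kernel_ofKernel]
  simp [opKernel]

/-- `ψ` is a multiplier of `H²_m(△ⁿ_P)`: `ψ f` belongs to the space for all `f` in it. -/
def IsMultiplier {n : ℕ} (P : PosRegTuple n) (m : Fin n → ℕ) (ψ : (Fin n → ℂ) → ℂ) : Prop :=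
  ∀ f : HardySpace P m, ∃ g : HardySpace P m, ∀ z : triangle P, g z = ψ z * f z

/-- Multiplication by a multiplier, a bounded operator by the closed graph theorem. -/
def mulOp {n : ℕ} {P : PosRegTuple n} {m : Fin n → ℕ} {ψ : (Fin n → ℂ) → ℂ}
    (h : IsMultiplier P m ψ) : HardySpace P m →L[ℂ] HardySpace P m :=
  ContinuousLinearMap.ofSeqClosedGraph
    (g :=
      { toFun := fun f => (h f).choose
        map_add' := fun f g => by
          refine RKHS.ext fun z => ?_
          rw [(h (f + g)).choose_spec z, RKHS.coe_add, RKHS.coe_add, Pi.add_apply, Pi.add_apply,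
            (h f).choose_spec z, (h g).choose_spec z, mul_add]
        map_smul' := fun c f => by
          refine RKHS.ext fun z => ?_
          rw [(h (c • f)).choose_spec z, RingHom.id_apply, RKHS.coe_smul, RKHS.coe_smul,
            Pi.smul_apply, Pi.smul_apply, (h f).choose_spec z, smul_eq_mul, smul_eq_mul]
          ring })
    (fun u x y hu hg => by
      refine RKHS.ext fun z => ?_
      have h1 := ((RKHS.continuous_eval z).tendsto y).comp hg
      have h2 := (((RKHS.continuous_eval z).tendsto x).comp hu).const_mul (ψ z)
      refine (tendsto_nhds_unique h1 (h2.congr fun N => ?_)).trans ((h x).choose_spec z).symm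
      exact ((h (u N)).choose_spec z).symm)

theorem mulOp_apply {n : ℕ} {P : PosRegTuple n} {m : Fin n → ℕ} {ψ : (Fin n → ℂ) → ℂ}
    (h : IsMultiplier P m ψ) (f : HardySpace P m) (z : triangle P) :
    mulOp h f z = ψ z * f z :=
  (h f).choose_spec z

/-- The joint kernel `ker(T - w) = ⋂_j ker(T_j - w_j)` of a tuple of bounded operators. -/
def jointKer {n : ℕ} {H : Type*} [NormedAddCommGroup H] [InnerProductSpace ℂ H]
    (T : Fin n → H →L[ℂ] H) (w : Fin n → ℂ) : Submodule ℂ H :=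
  ⨅ j, Module.End.eigenspace (T j : H →ₗ[ℂ] H) (w j)

/-- The (joint) point spectrum of a tuple of bounded operators. -/
def pointSpectrum {n : ℕ} {H : Type*} [NormedAddCommGroup H] [InnerProductSpace ℂ H]
    (T : Fin n → H →L[ℂ] H) : Set (Fin n → ℂ) :=
  {w | jointKer T w ≠ ⊥}

/-- The tuple `M_z^* = (M_{z_1}^*, …, M_{z_n}^*)` of Hilbert space adjoints. -/
def adjTuple {n : ℕ} {P : PosRegTuple n} {m : Fin n → ℕ}
    (h : ∀ j : Fin n, IsMultiplier P m (fun z => z j)) :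
    Fin n → HardySpace P m →L[ℂ] HardySpace P m :=
  fun j => ContinuousLinearMap.adjoint (mulOp (h j))

end

end GenHartogs

namespace GenHartogs

open scoped ComplexOrder ComplexConjugate InnerProductSpace Matrix

noncomputable section

/-! ### Absolutely convergent evaluation of power series -/

section evaluation

variable {n : ℕ}

/-! On the triangle the kernel expands as K(z,w) = ∑ e_α(z) conj(e_α(w)). Hence K(·,w) ↦ (conj
e_α(w))_α preserves inner products and extends to an isometry from the Hardy space into ℓ², whose
adjoint sends b to ∑ b_α e_α (`coeffMap`, `ofCoeff`). Neither surjectivity of this isometry nor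
orthonormality of the e_α is needed.

Multipliers: the linear term a_j z_j of P_j and m_j ≥ 1 give a_j A(α) ≤ A(α+ε_j). So multiplication
by φ_j is a bounded weighted shift on coefficients, and z_j = φ_j φ_{j+1} ⋯ φ_n is a multiplier as
well.

Eigenvectors: let f be a joint eigenvector of the adjoints for conj w, with w_2, …, w_n nonzero.
Cancelling w_{j+1} in z_j = φ_j z_{j+1} shows that f is an eigenvector of each adjoint of
multiplication by φ_j, for conj φ_j(w). Since e_α = √A(α) φ^α e_0, the α-th coefficient of f is
√A(α) conj(φ(w)^α) times the zeroth (`coeffMap_of_mem_jointKer`). This yields the series for f, and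
on the triangle it makes f a multiple of K(·,w).

Spectrum: if f ≠ 0, square summability of its coefficients says ∑ A(α)|φ(w)^α|² < ∞. As A dominates
the coefficients of (1 - P_j)⁻¹, the geometric series of P_j(φ(w) ⋄ conj φ(w)) converges, so this
value is below 1 and w lies in the triangle (`mem_triangle_of_summable`). Conversely, kernel
functions are nonzero joint eigenvectors. -/

theorem monom_zero (u : Fin n → ℂ) : monom u 0 = 1 := by simp [monom]

theorem monom_add (u : Fin n → ℂ) (α β : Fin n →₀ ℕ) :
    monom u (α + β) = monom u α * monom u β := by
  simp [monom, pow_add, Finset.prod_mul_distrib]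

theorem monom_mul (u v : Fin n → ℂ) (α : Fin n →₀ ℕ) :
    monom (fun i => u i * v i) α = monom u α * monom v α := by
  simp [monom, mul_pow, Finset.prod_mul_distrib]

theorem monom_conj (u : Fin n → ℂ) (α : Fin n →₀ ℕ) :
    monom (fun i => conj (u i)) α = conj (monom u α) := by
  simp [monom]

theorem monom_single_one (u : Fin n → ℂ) (i : Fin n) :
    monom u (Finsupp.single i 1) = u i := by
  classical
  rw [monom, Finset.prod_eq_single i]
  · simp
  · intro j _ hj
    simp [Finsupp.single_eq_of_ne hj]
  · simp

theorem monom_nonneg {u : Fin n → ℂ} (hu : ∀ i, 0 ≤ u i) (α : Fin n →₀ ℕ) : 0 ≤ monom u α :=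
  Finset.prod_nonneg fun i _ => pow_nonneg (hu i) _

/-- The power series `f` converges absolutely at `u`, with sum `c`. -/
def HasAbsSum (f : MvPowerSeries (Fin n) ℂ) (u : Fin n → ℂ) (c : ℂ) : Prop :=
  (Summable fun α => ‖MvPowerSeries.coeff α f * monom u α‖) ∧
    HasSum (fun α => MvPowerSeries.coeff α f * monom u α) c

theorem hasAbsSum_coe (p : MvPolynomial (Fin n) ℂ) (u : Fin n → ℂ) :
    HasAbsSum (p : MvPowerSeries (Fin n) ℂ) u (MvPolynomial.eval u p) := by
  have h0 : ∀ α ∉ p.support, MvPowerSeries.coeff α (p : MvPowerSeries (Fin n) ℂ) * monom u α = 0 := by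
    intro α hα
    rw [MvPolynomial.coeff_coe, MvPolynomial.notMem_support_iff.mp hα, zero_mul]
  refine ⟨summable_of_ne_finset_zero (s := p.support) fun α hα => by rw [h0 α hα, norm_zero], ?_⟩
  have h := hasSum_sum_of_ne_finset_zero (L := .unconditional _) h0
  rw [MvPolynomial.eval_eq']
  simpa only [MvPolynomial.coeff_coe, monom] using h

theorem hasAbsSum_one (u : Fin n → ℂ) : HasAbsSum 1 u 1 := by
  simpa using hasAbsSum_coe 1 u

theorem HasAbsSum.mul {f g : MvPowerSeries (Fin n) ℂ} {u : Fin n → ℂ} {c d : ℂ}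
    (hf : HasAbsSum f u c) (hg : HasAbsSum g u d) : HasAbsSum (f * g) u (c * d) := by
  classical
  have key : ∀ α, MvPowerSeries.coeff α (f * g) * monom u α =
      ∑ x ∈ Finset.HasAntidiagonal.antidiagonal α, (MvPowerSeries.coeff x.1 f * monom u x.1) *
        (MvPowerSeries.coeff x.2 g * monom u x.2) := by
    intro α
    rw [MvPowerSeries.coeff_mul, Finset.sum_mul]
    refine Finset.sum_congr rfl fun x hx => ?_
    rw [← Finset.HasAntidiagonal.mem_antidiagonal.mp hx, monom_add]
    ring
  have hs := summable_mul_of_summable_norm hf.1 hg.1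
  refine ⟨?_, ?_⟩
  · have hn := summable_sum_mul_antidiagonal_of_summable_mul
      (Summable.mul_of_nonneg hf.1 hg.1 (fun _ => norm_nonneg _) fun _ => norm_nonneg _)
    refine hn.of_nonneg_of_le (fun _ => norm_nonneg _) fun α => ?_
    rw [key]
    refine (norm_sum_le _ _).trans (Finset.sum_le_sum fun x _ => ?_)
    rw [norm_mul]
  · have h := hf.2.summable.tsum_mul_tsum_eq_tsum_sum_antidiagonal hg.2.summable hs
    have h2 := (summable_sum_mul_antidiagonal_of_summable_mul
      (f := fun α => MvPowerSeries.coeff α f * monom u α)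
      (g := fun α => MvPowerSeries.coeff α g * monom u α) hs).hasSum
    rw [← h, hf.2.tsum_eq, hg.2.tsum_eq] at h2
    rwa [funext key]

theorem HasAbsSum.pow {f : MvPowerSeries (Fin n) ℂ} {u : Fin n → ℂ} {c : ℂ}
    (hf : HasAbsSum f u c) (k : ℕ) : HasAbsSum (f ^ k) u (c ^ k) := by
  induction k with
  | zero => simpa using hasAbsSum_one u
  | succ k ih => simpa only [pow_succ] using ih.mul hf

theorem HasAbsSum.prod {ι : Type*} (s : Finset ι) {f : ι → MvPowerSeries (Fin n) ℂ}
    {u : Fin n → ℂ} {c : ι → ℂ} (hf : ∀ i ∈ s, HasAbsSum (f i) u (c i)) :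
    HasAbsSum (∏ i ∈ s, f i) u (∏ i ∈ s, c i) := by
  classical
  induction s using Finset.induction_on with
  | empty => simpa using hasAbsSum_one u
  | insert a s ha ih =>
    simp only [Finset.prod_insert ha]
    exact (hf a (Finset.mem_insert_self a s)).mul
      (ih fun i hi => hf i (Finset.mem_insert_of_mem hi))

theorem HasAbsSum.unique {f : MvPowerSeries (Fin n) ℂ} {u : Fin n → ℂ} {c d : ℂ}
    (hc : HasAbsSum f u c) (hd : HasAbsSum f u d) : c = d := hc.2.unique hd.2

/-- Since |x^α||y^α| ≤ |x^α|² + |y^α|², absolute convergence off the diagonal follows from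
convergence at two diagonal points. -/
theorem summable_norm_coeff_mul_monom {f : MvPowerSeries (Fin n) ℂ} {x y : Fin n → ℂ}
    (hx : Summable fun α => ‖MvPowerSeries.coeff α f * monom (fun i => x i * conj (x i)) α‖)
    (hy : Summable fun α => ‖MvPowerSeries.coeff α f * monom (fun i => y i * conj (y i)) α‖) :
    Summable fun α => ‖MvPowerSeries.coeff α f * monom (fun i => x i * conj (y i)) α‖ := by
  refine (hx.add hy).of_nonneg_of_le (fun _ => norm_nonneg _) fun α => ?_
  simp only [monom_mul, monom_conj, norm_mul, RCLike.norm_conj]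
  rw [← mul_add]
  refine mul_le_mul_of_nonneg_left ?_ (norm_nonneg _)
  nlinarith [sq_nonneg (‖monom x α‖ - ‖monom y α‖), mul_nonneg (norm_nonneg (monom x α))
    (norm_nonneg (monom y α))]

/-- The power series with nonnegative coefficients. -/
def nonnegSeries (n : ℕ) : Subsemiring (MvPowerSeries (Fin n) ℂ) where
  carrier := {f | ∀ α, 0 ≤ MvPowerSeries.coeff α f}
  mul_mem' hf hg := coeff_mul_nonneg hf hg
  one_mem' := coeff_one_nonneg
  add_mem' hf hg α := by
    rw [map_add]
    exact add_nonneg (hf α) (hg α)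
  zero_mem' α := by simp

theorem mul_coeff_le_coeff_mul {f g : MvPowerSeries (Fin n) ℂ} (hf : f ∈ nonnegSeries n)
    (hg : g ∈ nonnegSeries n) (α β : Fin n →₀ ℕ) :
    MvPowerSeries.coeff α f * MvPowerSeries.coeff β g ≤ MvPowerSeries.coeff (α + β) (f * g) := by
  classical
  rw [MvPowerSeries.coeff_mul]
  exact Finset.single_le_sum
    (f := fun x : (Fin n →₀ ℕ) × (Fin n →₀ ℕ) =>
      MvPowerSeries.coeff x.1 f * MvPowerSeries.coeff x.2 g)
    (fun x _ => mul_nonneg (hf _) (hg _)) (Finset.HasAntidiagonal.mem_antidiagonal.mpr rfl : (α, β) ∈ _)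

theorem norm_eq_re_of_nonneg {c : ℂ} (hc : 0 ≤ c) : ‖c‖ = c.re :=
  congrArg Complex.re (Complex.norm_of_nonneg' hc)

theorem eval_le_of_hasAbsSum {f : MvPowerSeries (Fin n) ℂ} {p : MvPolynomial (Fin n) ℂ}
    {u : Fin n → ℂ} {c : ℂ} (hu : ∀ i, 0 ≤ u i)
    (hle : ∀ α, p.coeff α ≤ MvPowerSeries.coeff α f) (hf : HasAbsSum f u c) :
    (MvPolynomial.eval u p).re ≤ c.re := by
  refine hasSum_le (fun α => ?_) (Complex.hasSum_re (hasAbsSum_coe p u).2) (Complex.hasSum_re hf.2)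
  rw [MvPolynomial.coeff_coe]
  exact (Complex.le_def.mp (mul_le_mul_of_nonneg_right (hle α) (monom_nonneg hu α))).1

end evaluation

/-! ### The series `(1 - P_j)⁻¹` and the coefficients `A_{P,m}` -/

section series

variable {n : ℕ} (P : PosRegTuple n)

/-- The power series `(1 - P_j)⁻¹`. -/
def geomSeries (j : Fin n) : MvPowerSeries (Fin n) ℂ :=
  (1 - (P.poly j : MvPowerSeries (Fin n) ℂ))⁻¹

theorem constantCoeff_coe_poly (j : Fin n) :
    MvPowerSeries.constantCoeff (P.poly j : MvPowerSeries (Fin n) ℂ) = 0 := by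
  rw [← MvPowerSeries.coeff_zero_eq_constantCoeff_apply, MvPolynomial.coeff_coe,
    ← MvPolynomial.constantCoeff_eq, constantCoeff_poly]

theorem one_sub_mul_geomSeries (j : Fin n) :
    (1 - (P.poly j : MvPowerSeries (Fin n) ℂ)) * geomSeries P j = 1 :=
  MvPowerSeries.mul_inv_cancel _ (by rw [map_sub, constantCoeff_coe_poly]; simp)

theorem constantCoeff_geomSeries (j : Fin n) :
    MvPowerSeries.constantCoeff (geomSeries P j) = 1 := by
  have h := congrArg MvPowerSeries.constantCoeff (one_sub_mul_geomSeries P j)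
  rw [map_mul, map_sub, constantCoeff_coe_poly] at h
  simpa using h

theorem geomSeries_mem (j : Fin n) : geomSeries P j ∈ nonnegSeries n := inv_one_sub_nonneg P j

theorem poly_mem (j : Fin n) : (P.poly j : MvPowerSeries (Fin n) ℂ) ∈ nonnegSeries n := fun α => by
  rw [MvPolynomial.coeff_coe]
  exact P.coeff_nonneg j α

/-- G = 1 + P_j G, iterated N times. The remainder has nonnegative coefficients and order at least
N, which gives a coefficientwise lower bound for G and exact agreement in degrees below N. -/
theorem geomSeries_eq (j : Fin n) (N : ℕ) :
    geomSeries P j = ((∑ k ∈ Finset.range N, P.poly j ^ k : MvPolynomial (Fin n) ℂ) :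
        MvPowerSeries (Fin n) ℂ) + (P.poly j : MvPowerSeries (Fin n) ℂ) ^ N * geomSeries P j := by
  have h := one_sub_mul_geomSeries P j
  induction N with
  | zero => simp
  | succ N ih =>
    nth_rewrite 1 [ih]
    rw [Finset.sum_range_succ, MvPolynomial.coe_add, MvPolynomial.coe_pow]
    linear_combination (P.poly j : MvPowerSeries (Fin n) ℂ) ^ N * h

theorem coeff_sum_pow_le (j : Fin n) (N : ℕ) (α : Fin n →₀ ℕ) :
    (∑ k ∈ Finset.range N, P.poly j ^ k).coeff α ≤ MvPowerSeries.coeff α (geomSeries P j) := by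
  rw [geomSeries_eq P j N, map_add, MvPolynomial.coeff_coe]
  exact le_add_of_nonneg_right
    (mul_mem (pow_mem (poly_mem P j) N) (geomSeries_mem P j) α)

theorem coeff_geomSeries_of_degree_lt (j : Fin n) {N : ℕ} {α : Fin n →₀ ℕ} (h : α.degree < N) :
    MvPowerSeries.coeff α (geomSeries P j) = (∑ k ∈ Finset.range N, P.poly j ^ k).coeff α := by
  have h0 : MvPowerSeries.coeff α
      ((P.poly j : MvPowerSeries (Fin n) ℂ) ^ N * geomSeries P j) = 0 := by
    refine MvPowerSeries.coeff_of_lt_order ?_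
    have h1 := MvPowerSeries.le_order_pow_of_constantCoeff_eq_zero N (constantCoeff_coe_poly P j)
    calc (α.degree : ℕ∞) < N := by exact_mod_cast h
      _ ≤ _ := h1
      _ ≤ _ := le_self_add
      _ ≤ _ := MvPowerSeries.le_order_mul
  rw [geomSeries_eq P j N, map_add, h0, add_zero, MvPolynomial.coeff_coe]

/-- At a nonnegative point all terms are nonnegative, so it suffices to bound finite sums; each is
at most ∑_{k<N} P_j(u)^k for some N, hence at most 1/(1 - P_j(u)). -/
theorem summable_geomSeries (j : Fin n) {u : Fin n → ℂ} (hu : ∀ i, 0 ≤ u i)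
    (h1 : MvPolynomial.eval u (P.poly j) < 1) :
    Summable fun α => ‖MvPowerSeries.coeff α (geomSeries P j) * monom u α‖ := by
  set x := MvPolynomial.eval u (P.poly j) with hx
  have hx0 : 0 ≤ x := by
    rw [hx, MvPolynomial.eval_eq']
    exact Finset.sum_nonneg fun α _ => mul_nonneg (P.coeff_nonneg j α) (monom_nonneg hu α)
  have hxr : x = (x.re : ℂ) := Complex.ext rfl (Complex.le_def.mp hx0).2.symm
  have hr0 : 0 ≤ x.re := (Complex.le_def.mp hx0).1
  have hr1 : x.re < 1 := (Complex.lt_def.mp h1).1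
  refine summable_of_sum_le (c := (1 - x.re)⁻¹) (fun _ => norm_nonneg _) fun s => ?_
  -- N exceeds the degree of every index in `s`, so there the series may be replaced by its
  -- polynomial truncation.
  set N := s.sup Finsupp.degree + 1
  have hs : ∀ α ∈ s, ‖MvPowerSeries.coeff α (geomSeries P j) * monom u α‖ =
      ‖MvPowerSeries.coeff α ((∑ k ∈ Finset.range N, P.poly j ^ k : MvPolynomial (Fin n) ℂ) :
        MvPowerSeries (Fin n) ℂ) * monom u α‖ := fun α hα => by
    rw [coeff_geomSeries_of_degree_lt P j (Nat.lt_succ_of_le (Finset.le_sup hα)),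
      MvPolynomial.coeff_coe]
  rw [Finset.sum_congr rfl hs]
  have hpos : ∀ α, 0 ≤ MvPowerSeries.coeff α
      ((∑ k ∈ Finset.range N, P.poly j ^ k : MvPolynomial (Fin n) ℂ) :
        MvPowerSeries (Fin n) ℂ) * monom u α := fun α => by
    refine mul_nonneg ?_ (monom_nonneg hu α)
    have := sum_mem (S := nonnegSeries n) (t := Finset.range N)
      (f := fun k => (P.poly j : MvPowerSeries (Fin n) ℂ) ^ k)
      fun k _ => pow_mem (poly_mem P j) k
    simpa [← MvPolynomial.coeToMvPowerSeries.ringHom_apply] using this α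
  simp only [norm_eq_re_of_nonneg (hpos _)]
  refine (sum_le_hasSum s (fun α _ => (Complex.le_def.mp (hpos α)).1)
    (Complex.hasSum_re (hasAbsSum_coe _ u).2)).trans ?_
  rw [map_sum]
  simp only [map_pow, ← hx]
  rw [hxr]
  norm_cast
  rw [← tsum_geometric_of_lt_one hr0 hr1]
  exact (summable_geometric_of_lt_one hr0 hr1).sum_le_tsum _ fun k _ => pow_nonneg hr0 k

/-- Evaluating (1 - P_j) G = 1 at u determines the sum; it also shows that P_j(u) ≠ 1, which
therefore need not be assumed. -/
theorem hasAbsSum_geomSeries (j : Fin n) {u : Fin n → ℂ}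
    (h : Summable fun α => ‖MvPowerSeries.coeff α (geomSeries P j) * monom u α‖) :
    HasAbsSum (geomSeries P j) u (1 / (1 - MvPolynomial.eval u (P.poly j))) := by
  have hs : HasAbsSum (geomSeries P j) u _ := ⟨h, h.of_norm.hasSum⟩
  have h1 := hasAbsSum_coe (1 - P.poly j) u
  have hcoe : ((1 - P.poly j : MvPolynomial (Fin n) ℂ) : MvPowerSeries (Fin n) ℂ) =
      1 - (P.poly j : MvPowerSeries (Fin n) ℂ) := by
    simp only [← MvPolynomial.coeToMvPowerSeries.ringHom_apply, map_sub, map_one]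
  have h2 := h1.mul hs
  rw [hcoe, one_sub_mul_geomSeries, map_sub, map_one] at h2
  have h3 := h2.unique (hasAbsSum_one u)
  rwa [eq_one_div_of_mul_eq_one_right h3] at hs

variable (m : Fin n → ℕ)

theorem coeffSeries_eq : coeffSeries P m = ∏ j, geomSeries P j ^ m j := rfl

theorem coeffSeries_mem : coeffSeries P m ∈ nonnegSeries n := coeffSeries_nonneg P m

theorem coe_coeffFun (α : Fin n →₀ ℕ) :
    (coeffFun P m α : ℂ) = MvPowerSeries.coeff α (coeffSeries P m) :=
  Complex.ext rfl (Complex.le_def.mp (coeffSeries_nonneg P m α)).2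

theorem coeffFun_nonneg (α : Fin n →₀ ℕ) : 0 ≤ coeffFun P m α :=
  (Complex.le_def.mp (coeffSeries_nonneg P m α)).1

theorem coeffFun_zero : coeffFun P m 0 = 1 := by
  rw [coeffFun, MvPowerSeries.coeff_zero_eq_constantCoeff_apply, coeffSeries_eq, map_prod]
  simp [constantCoeff_geomSeries]

/-- Here m_j ≥ 1 enters: one factor (1 - P_j)⁻¹ can be split off, and the cofactor still has
nonnegative coefficients. -/
theorem exists_coeffSeries_eq_mul {j : Fin n} (hm : 1 ≤ m j) :
    ∃ R ∈ nonnegSeries n, MvPowerSeries.constantCoeff R = 1 ∧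
      coeffSeries P m = geomSeries P j * R := by
  classical
  refine ⟨geomSeries P j ^ (m j - 1) * ∏ i ∈ Finset.univ.erase j, geomSeries P i ^ m i,
    mul_mem (pow_mem (geomSeries_mem P j) _)
      (prod_mem fun i _ => pow_mem (geomSeries_mem P i) _), ?_, ?_⟩
  · simp [constantCoeff_geomSeries, map_prod]
  · rw [coeffSeries_eq, ← Finset.mul_prod_erase _ _ (Finset.mem_univ j), ← mul_assoc, ← pow_succ',
      Nat.sub_add_cancel hm]

theorem coeff_geomSeries_le {j : Fin n} (hm : 1 ≤ m j) (α : Fin n →₀ ℕ) :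
    MvPowerSeries.coeff α (geomSeries P j) ≤ MvPowerSeries.coeff α (coeffSeries P m) := by
  obtain ⟨R, hR, h1, h⟩ := exists_coeffSeries_eq_mul P m hm
  have := mul_coeff_le_coeff_mul (geomSeries_mem P j) hR α 0
  rwa [MvPowerSeries.coeff_zero_eq_constantCoeff_apply, h1, mul_one, add_zero, ← h] at this

/-- The constant is the coefficient of z_j in P_j. This growth estimate is what bounds
multiplication by φ_j. -/
theorem exists_coeffFun_add_single_ge {j : Fin n} (hm : 1 ≤ m j) :
    ∃ a : ℝ, 0 < a ∧ ∀ α, a * coeffFun P m α ≤ coeffFun P m (α + Finsupp.single j 1) := by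
  obtain ⟨a, N, Q, ha, hQ, hP⟩ := P.expansion j
  refine ⟨a, ha, fun α => ?_⟩
  obtain ⟨R, hR, -, h⟩ := exists_coeffSeries_eq_mul P m hm
  -- This is (1 - P_j)⁻¹ = 1 + P_j (1 - P_j)⁻¹ multiplied by R.
  have hF : coeffSeries P m = R + (P.poly j : MvPowerSeries (Fin n) ℂ) * coeffSeries P m := by
    rw [h]
    linear_combination R * one_sub_mul_geomSeries P j
  have hc : MvPowerSeries.coeff (Finsupp.single j 1) (P.poly j : MvPowerSeries (Fin n) ℂ) = a := by
    rw [MvPolynomial.coeff_coe, hP, MvPolynomial.coeff_add, MvPolynomial.coeff_C_mul,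
      MvPolynomial.coeff_X, if_pos rfl, mul_one, MvPolynomial.coeff_sum, Finset.sum_eq_zero, add_zero]
    intro k hk
    refine (hQ k).coeff_eq_zero ?_
    rw [Finset.mem_Icc] at hk
    simp
    omega
  have h1 := mul_coeff_le_coeff_mul (poly_mem P j) (coeffSeries_mem P m) (Finsupp.single j 1) α
  rw [hc, add_comm _ α] at h1
  have h2 : MvPowerSeries.coeff (α + Finsupp.single j 1)
      ((P.poly j : MvPowerSeries (Fin n) ℂ) * coeffSeries P m) ≤
      MvPowerSeries.coeff (α + Finsupp.single j 1) (coeffSeries P m) := by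
    nth_rewrite 2 [hF]
    rw [map_add]
    exact le_add_of_nonneg_left (hR _)
  have h3 := h1.trans h2
  rw [← coe_coeffFun, ← coe_coeffFun] at h3
  exact_mod_cast h3

end series

/-! ### Expansion of the kernel and coefficient sequences -/

section kernel

variable {n : ℕ} (P : PosRegTuple n) (m : Fin n → ℕ)

theorem mul_conj_nonneg (c : ℂ) : 0 ≤ c * conj c := by
  rw [mul_comm]
  exact star_mul_self_nonneg c

theorem tailProd_ne_zero {z : Fin n → ℂ} (hz : z ∈ puncturedSpace n) : tailProd z ≠ 0 :=
  Finset.prod_ne_zero_iff.mpr fun j hj => hz j (Finset.mem_filter.mp hj).2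

theorem one_sub_polyVal_ne_zero (j : Fin n) {z w : Fin n → ℂ} (hz : z ∈ triangle P)
    (hw : w ∈ triangle P) : 1 - polyVal P j z w ≠ 0 := by
  intro h
  have := polyVal_norm_lt P j hz hw
  rw [← sub_eq_zero.mp h, norm_one] at this
  exact lt_irrefl _ this

theorem scalarKernel_ne_zero {z w : Fin n → ℂ} (hz : z ∈ triangle P) (hw : w ∈ triangle P) :
    scalarKernel P m z w ≠ 0 := by
  refine mul_ne_zero (Finset.prod_ne_zero_iff.mpr fun j hj => ?_)
    (Finset.prod_ne_zero_iff.mpr fun j _ => ?_)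
  · have hj' := (Finset.mem_filter.mp hj).2
    exact one_div_ne_zero (mul_ne_zero (hz.1 j hj') (by simpa using hw.1 j hj'))
  · exact one_div_ne_zero (pow_ne_zero _ (one_sub_polyVal_ne_zero P j hz hw))

theorem hasAbsSum_coeffSeries {z w : Fin n → ℂ} (hz : z ∈ triangle P) (hw : w ∈ triangle P) :
    HasAbsSum (coeffSeries P m) (fun i => phi z i * conj (phi w i))
      (∏ j, 1 / (1 - polyVal P j z w) ^ m j) := by
  rw [coeffSeries_eq]
  refine HasAbsSum.prod _ fun j _ => ?_
  rw [← one_div_pow]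
  exact (hasAbsSum_geomSeries P j (summable_norm_coeff_mul_monom
    (summable_geomSeries P j (fun i => mul_conj_nonneg _) (hz.2 j))
    (summable_geomSeries P j (fun i => mul_conj_nonneg _) (hw.2 j)))).pow _

theorem basisFun_mul_conj (α : Fin n →₀ ℕ) (z w : Fin n → ℂ) :
    basisFun P m α z * conj (basisFun P m α w) =
      (∏ j ∈ Finset.univ.filter (fun j : Fin n => 0 < j.val), 1 / (z j * conj (w j))) *
        (MvPowerSeries.coeff α (coeffSeries P m) *
          monom (fun i => phi z i * conj (phi w i)) α) := by
  have h1 : (Real.sqrt (coeffFun P m α) : ℂ) * Real.sqrt (coeffFun P m α) =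
      MvPowerSeries.coeff α (coeffSeries P m) := by
    rw [← coe_coeffFun, ← Complex.ofReal_mul, Real.mul_self_sqrt (coeffFun_nonneg P m α)]
  rw [← h1, monom_mul, monom_conj]
  simp only [basisFun, tailProd, map_div₀, map_mul, map_prod, Complex.conj_ofReal, one_div,
    mul_inv, Finset.prod_mul_distrib, Finset.prod_inv_distrib]
  ring

theorem hasSum_basisFun_mul_conj {z w : Fin n → ℂ} (hz : z ∈ triangle P) (hw : w ∈ triangle P) :
    HasSum (fun α => basisFun P m α z * conj (basisFun P m α w)) (scalarKernel P m z w) := by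
  simp only [basisFun_mul_conj]
  exact (hasAbsSum_coeffSeries P m hz hw).2.mul_left _

theorem summable_basisFun_sq {w : Fin n → ℂ} (hw : w ∈ triangle P) :
    Summable fun α => ‖basisFun P m α w‖ ^ 2 := by
  refine (Complex.hasSum_re (hasSum_basisFun_mul_conj P m hw hw)).summable.congr fun α => ?_
  rw [Complex.mul_conj, Complex.normSq_eq_norm_sq, Complex.ofReal_re]

/-- The sequence space `ℓ²(ℤ₊ⁿ)`. -/
abbrev SeqSpace (n : ℕ) : Type := lp (fun _ : Fin n →₀ ℕ => ℂ) 2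

theorem memlp_of_summable_sq {b : (Fin n →₀ ℕ) → ℂ} (hb : Summable fun α => ‖b α‖ ^ 2) :
    Memℓp b 2 := memℓp_gen (by simpa using hb)

theorem summable_norm_sq (b : SeqSpace n) : Summable fun α => ‖b α‖ ^ 2 := by
  simpa using (memℓp_gen_iff (p := 2) (by simp)).mp (lp.memℓp b)

/-- The sequence `α ↦ conj e_α(w)`. -/
def kernelSeq (w : triangle P) : SeqSpace n :=
  ⟨fun α => conj (basisFun P m α w),
    memlp_of_summable_sq (by simpa using summable_basisFun_sq P m w.2)⟩

theorem kernelSeq_apply (w : triangle P) (α : Fin n →₀ ℕ) :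
    kernelSeq P m w α = conj (basisFun P m α w) := rfl

theorem hasSum_inner_kernelSeq (z : triangle P) (b : SeqSpace n) :
    HasSum (fun α => b α * basisFun P m α z) ⟪kernelSeq P m z, b⟫_ℂ := by
  have h := lp.hasSum_inner (𝕜 := ℂ) (kernelSeq P m z) b
  simpa [kernelSeq_apply, RCLike.inner_apply] using h

theorem inner_kernelFun (z : triangle P) (f : HardySpace P m) :
    ⟪kernelFun P m z, f⟫_ℂ = f z := by
  rw [kernelFun, RKHS.kerFun_inner]
  simp [RCLike.inner_apply]

theorem inner_kernelSeq_kernelSeq (z w : triangle P) :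
    ⟪kernelSeq P m z, kernelSeq P m w⟫_ℂ = ⟪kernelFun P m z, kernelFun P m w⟫_ℂ := by
  rw [inner_kernelFun, kernelFun_apply]
  refine (hasSum_inner_kernelSeq P m z _).unique ?_
  simpa only [kernelSeq_apply, mul_comm] using hasSum_basisFun_mul_conj P m z.2 w.2

theorem span_kernelFun_dense :
    (Submodule.span ℂ (Set.range (kernelFun P m))).topologicalClosure = ⊤ := by
  rw [← RKHS.kerFun_dense (𝕜 := ℂ) (H := HardySpace P m) (X := triangle P) (V := ℂ)]
  congr 1
  refine le_antisymm (Submodule.span_mono ?_) (Submodule.span_le.mpr ?_)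
  · rintro _ ⟨w, rfl⟩
    exact ⟨w, 1, rfl⟩
  · rintro _ ⟨w, v, rfl⟩
    have : RKHS.kerFun (HardySpace P m) w v = v • kernelFun P m w := by
      rw [kernelFun, ← map_smul, smul_eq_mul, mul_one]
    rw [this]
    exact Submodule.smul_mem _ _ (Submodule.subset_span ⟨w, rfl⟩)

/-- Equal Gram matrices give equal norms of corresponding finite combinations, so the map on the
span is well defined even if the `k x` are linearly dependent; density and completeness extend it.
-/
theorem exists_linearIsometry_of_inner_eq {X E F : Type*} [NormedAddCommGroup E]
    [InnerProductSpace ℂ E] [NormedAddCommGroup F] [InnerProductSpace ℂ F] [CompleteSpace F]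
    (k : X → E) (v : X → F) (hk : (Submodule.span ℂ (Set.range k)).topologicalClosure = ⊤)
    (h : ∀ x y, ⟪v x, v y⟫_ℂ = ⟪k x, k y⟫_ℂ) : ∃ V : E →ₗᵢ[ℂ] F, ∀ x, V (k x) = v x := by
  let e := Finsupp.linearCombination ℂ k
  let f := Finsupp.linearCombination ℂ v
  have hnorm : ∀ c, ‖f c‖ = ‖e c‖ := fun c => by
    have hi : ⟪f c, f c⟫_ℂ = ⟪e c, e c⟫_ℂ := by
      simp only [f, e, Finsupp.linearCombination_apply, Finsupp.sum_inner, Finsupp.inner_sum,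
        inner_smul_left, inner_smul_right, h]
    rw [norm_eq_sqrt_re_inner (𝕜 := ℂ), hi, ← norm_eq_sqrt_re_inner]
  have hd : DenseRange e := by
    rw [DenseRange, ← LinearMap.coe_range, Finsupp.range_linearCombination]
    exact Submodule.dense_iff_topologicalClosure_eq_top.mpr hk
  have hext : ∀ c, f.extendOfNorm e (e c) = f c :=
    LinearMap.extendOfNorm_eq hd ⟨1, fun c => by rw [hnorm, one_mul]⟩
  refine ⟨⟨(f.extendOfNorm e : E →ₗ[ℂ] F), fun x => ?_⟩, fun x => ?_⟩
  · refine hd.induction_on x (isClosed_eq (f.extendOfNorm e).continuous.norm continuous_norm) ?_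
    intro c
    exact (congrArg norm (hext c)).trans (hnorm c)
  · have := hext (Finsupp.single x 1)
    simpa [e, f] using this

/-- The isometry sending a function in `H²_m(△ⁿ_P)` to its sequence of coefficients. -/
def coeffMap : HardySpace P m →ₗᵢ[ℂ] SeqSpace n :=
  (exists_linearIsometry_of_inner_eq _ _ (span_kernelFun_dense P m)
    (inner_kernelSeq_kernelSeq P m)).choose

theorem coeffMap_kernelFun (w : triangle P) : coeffMap P m (kernelFun P m w) = kernelSeq P m w :=
  (exists_linearIsometry_of_inner_eq _ _ (span_kernelFun_dense P m)
    (inner_kernelSeq_kernelSeq P m)).choose_spec w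

theorem hasSum_coeffMap (f : HardySpace P m) (z : triangle P) :
    HasSum (fun α => coeffMap P m f α * basisFun P m α z) (f z) := by
  have h := hasSum_inner_kernelSeq P m z (coeffMap P m f)
  rwa [← coeffMap_kernelFun, LinearIsometry.inner_map_map, inner_kernelFun] at h

/-- The function `∑ b_α e_α` for a square summable sequence `b`. -/
def ofCoeff (b : SeqSpace n) : HardySpace P m :=
  ContinuousLinearMap.adjoint (coeffMap P m).toContinuousLinearMap b

theorem inner_ofCoeff (b : SeqSpace n) (f : HardySpace P m) :
    ⟪ofCoeff P m b, f⟫_ℂ = ⟪b, coeffMap P m f⟫_ℂ := by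
  rw [ofCoeff, ContinuousLinearMap.adjoint_inner_left]
  rfl

theorem hasSum_ofCoeff (b : SeqSpace n) (z : triangle P) :
    HasSum (fun α => b α * basisFun P m α z) (ofCoeff P m b z) := by
  have h := hasSum_inner_kernelSeq P m z b
  rwa [← coeffMap_kernelFun, ← inner_conj_symm, ← inner_ofCoeff, inner_conj_symm,
    inner_kernelFun] at h

/-- The function `e_α` as an element of the space. -/
def basisVec (α : Fin n →₀ ℕ) : HardySpace P m := by
  classical exact ofCoeff P m (lp.single 2 α (1 : ℂ))

theorem basisVec_apply (α : Fin n →₀ ℕ) (z : triangle P) :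
    basisVec P m α z = basisFun P m α z := by
  classical
  refine (hasSum_ofCoeff P m (lp.single 2 α (1 : ℂ)) z).unique ?_
  convert hasSum_single (L := .unconditional _) α fun β hβ => ?_ using 1
  · simp
  · simp [lp.single_apply, Pi.single_eq_of_ne hβ]

theorem inner_basisVec (α : Fin n →₀ ℕ) (f : HardySpace P m) :
    ⟪basisVec P m α, f⟫_ℂ = coeffMap P m f α := by
  classical
  rw [basisVec, inner_ofCoeff, lp.inner_single_left]
  simp [RCLike.inner_apply]

/-! ### Multipliers -/

theorem IsMultiplier.mul {P : PosRegTuple n} {m : Fin n → ℕ} {ψ χ : (Fin n → ℂ) → ℂ}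
    (hψ : IsMultiplier P m ψ) (hχ : IsMultiplier P m χ) :
    IsMultiplier P m fun z => ψ z * χ z := fun f => by
  obtain ⟨g, hg⟩ := hχ f
  obtain ⟨k, hk⟩ := hψ g
  exact ⟨k, fun z => by rw [hk, hg, mul_assoc]⟩

theorem IsMultiplier.congr {P : PosRegTuple n} {m : Fin n → ℕ} {ψ χ : (Fin n → ℂ) → ℂ}
    (hψ : IsMultiplier P m ψ) (h : ∀ z ∈ triangle P, χ z = ψ z) : IsMultiplier P m χ := fun f => by
  obtain ⟨g, hg⟩ := hψ f
  exact ⟨g, fun z => by rw [hg, h z z.2]⟩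

/-- φ_j e_α = r_α e_{α+ε_j} with r_α² = A(α)/A(α+ε_j) ≤ 1/a, so the shifted coefficient sequence
remains square summable. -/
theorem isMultiplier_phi {j : Fin n} (hm : 1 ≤ m j) : IsMultiplier P m fun z => phi z j := by
  intro f
  obtain ⟨a, ha, hA⟩ := exists_coeffFun_add_single_ge P m hm
  let s : (Fin n →₀ ℕ) → (Fin n →₀ ℕ) := fun α => α + Finsupp.single j 1
  have hs : Function.Injective s := add_left_injective _
  let r : (Fin n →₀ ℕ) → ℝ := fun α => √(coeffFun P m α) / √(coeffFun P m (s α))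
  have hr : ∀ α, r α * √(coeffFun P m (s α)) = √(coeffFun P m α) := fun α => by
    -- If A(α+ε_j) = 0, the growth estimate forces A(α) = 0, so the convention x/0 = 0 does no harm.
    refine div_mul_cancel_of_imp fun h => ?_
    have h1 := (Real.sqrt_eq_zero (coeffFun_nonneg P m _)).mp h
    have h2 := hA α
    have h3 := coeffFun_nonneg P m α
    rw [Real.sqrt_eq_zero h3]
    change coeffFun P m (α + Finsupp.single j 1) = 0 at h1
    nlinarith
  have hr2 : ∀ α, (r α) ^ 2 ≤ a⁻¹ := fun α => by
    rw [div_pow, Real.sq_sqrt (coeffFun_nonneg P m _), Real.sq_sqrt (coeffFun_nonneg P m _)]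
    refine div_le_of_le_mul₀ (coeffFun_nonneg P m _) (inv_nonneg.mpr ha.le) ?_
    rw [inv_mul_eq_div, le_div_iff₀ ha, mul_comm]
    exact hA α
  let b : (Fin n →₀ ℕ) → ℂ := Function.extend s (fun α => coeffMap P m f α * r α) 0
  have hbs : ∀ α, b (s α) = coeffMap P m f α * r α := fun α => hs.extend_apply _ _ _
  have hb0 : ∀ β ∉ Set.range s, b β = 0 := fun β hβ =>
    Function.extend_apply' _ _ _ fun ⟨α, h⟩ => hβ ⟨α, h⟩
  have hb : Summable fun β => ‖b β‖ ^ 2 := by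
    refine (hs.summable_iff fun β hβ => by rw [hb0 β hβ]; simp).mp ?_
    refine ((summable_norm_sq (coeffMap P m f)).mul_right a⁻¹).of_nonneg_of_le
      (fun _ => sq_nonneg _) fun α => ?_
    rw [Function.comp_apply, hbs, norm_mul, mul_pow, Complex.norm_real, Real.norm_eq_abs, sq_abs]
    exact mul_le_mul_of_nonneg_left (hr2 α) (sq_nonneg _)
  refine ⟨ofCoeff P m ⟨b, memlp_of_summable_sq hb⟩, fun z => ?_⟩
  refine (hasSum_ofCoeff P m ⟨b, memlp_of_summable_sq hb⟩ z).unique ?_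
  refine (hs.hasSum_iff fun β hβ => ?_).mp ?_
  · change b β * _ = 0
    rw [hb0 β hβ, zero_mul]
  · refine ((hasSum_coeffMap P m f z).mul_left (phi z j)).congr_fun ?_
    intro α
    change b (s α) * basisFun P m (s α) z = _
    rw [hbs, basisFun, basisFun, monom_add, monom_single_one, ← hr α]
    push_cast
    ring

theorem coord_eq_phi_mul {z : Fin n → ℂ} (hz : z ∈ puncturedSpace n) (j : Fin n)
    (h : j.val + 1 < n) : z j = phi z j * z ⟨j.val + 1, h⟩ := by
  rw [phi, dif_pos h, div_mul_cancel₀]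
  exact hz _ (Nat.succ_pos _)

theorem isMultiplier_coord (hm : ∀ j, 1 ≤ m j) (j : Fin n) : IsMultiplier P m fun z => z j := by
  -- Descending induction from the last coordinate, where z_n = φ_n; the case n - j = 0 is vacuous.
  induction h : n - j.val generalizing j with
  | zero => omega
  | succ k ih =>
    by_cases hj : j.val + 1 < n
    · exact ((isMultiplier_phi P m (hm j)).mul (ih ⟨j.val + 1, hj⟩ (by simp; omega))).congr
        fun z hz => coord_eq_phi_mul hz.1 j hj
    · refine (isMultiplier_phi P m (hm j)).congr fun z _ => ?_
      rw [phi, dif_neg hj]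

end kernel

/-! ### Joint eigenvectors of the adjoint tuple -/

section eigenvectors

variable {n : ℕ} {P : PosRegTuple n} {m : Fin n → ℕ}

theorem mem_jointKer_iff {H : Type*} [NormedAddCommGroup H] [InnerProductSpace ℂ H]
    {T : Fin n → H →L[ℂ] H} {w : Fin n → ℂ} {f : H} :
    f ∈ jointKer T w ↔ ∀ j, T j f = w j • f := by
  simp only [jointKer, Submodule.mem_iInf, Module.End.mem_eigenspace_iff]
  rfl

theorem adjoint_mulOp_kernelFun {ψ : (Fin n → ℂ) → ℂ} (h : IsMultiplier P m ψ) (w : triangle P) :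
    ContinuousLinearMap.adjoint (mulOp h) (kernelFun P m w) = conj (ψ w) • kernelFun P m w := by
  refine ext_inner_right ℂ fun f => ?_
  rw [ContinuousLinearMap.adjoint_inner_left, inner_kernelFun, mulOp_apply, inner_smul_left,
    inner_kernelFun, Complex.conj_conj]

theorem kernelFun_mem_jointKer (hM : ∀ j : Fin n, IsMultiplier P m (fun z => z j))
    (w : triangle P) : kernelFun P m w ∈ jointKer (adjTuple hM) (star (w : Fin n → ℂ)) :=
  mem_jointKer_iff.mpr fun j => adjoint_mulOp_kernelFun (hM j) w

theorem kernelFun_ne_zero (w : triangle P) : kernelFun P m w ≠ 0 := fun h =>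
  scalarKernel_ne_zero P m w.2 w.2 (by rw [← kernelFun_apply, h]; simp)

/-- The adjoint of multiplication by z_j = φ_j z_{j+1}, applied to f, gives conj(w_{j+1}) M_{φ_j}^*
f = conj(w_j) f, and w_{j+1} ≠ 0 can be cancelled. -/
theorem adjoint_mulOp_phi (hM : ∀ j : Fin n, IsMultiplier P m (fun z => z j))
    (hφ : ∀ j : Fin n, IsMultiplier P m (fun z => phi z j)) {w : Fin n → ℂ}
    (hw : w ∈ puncturedSpace n) {f : HardySpace P m} (hf : f ∈ jointKer (adjTuple hM) (star w))
    (j : Fin n) : ContinuousLinearMap.adjoint (mulOp (hφ j)) f = conj (phi w j) • f := by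
  have hf' : ∀ i, ContinuousLinearMap.adjoint (mulOp (hM i)) f = conj (w i) • f :=
    mem_jointKer_iff.mp hf
  by_cases hj : j.val + 1 < n
  · have hcomp : mulOp (hM j) = mulOp (hM ⟨j.val + 1, hj⟩) ∘L mulOp (hφ j) := by
      refine ContinuousLinearMap.ext fun g => RKHS.ext fun z => ?_
      rw [ContinuousLinearMap.comp_apply, mulOp_apply, mulOp_apply, mulOp_apply,
        coord_eq_phi_mul z.2.1 j hj]
      ring
    have h := hf' j
    rw [hcomp, ContinuousLinearMap.adjoint_comp, ContinuousLinearMap.comp_apply, hf', map_smul,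
      coord_eq_phi_mul hw j hj, map_mul, mul_comm, mul_smul] at h
    refine smul_right_injective _ ?_ h
    simpa using hw _ (Nat.succ_pos _)
  · have hcomp : mulOp (hφ j) = mulOp (hM j) := by
      refine ContinuousLinearMap.ext fun g => RKHS.ext fun z => ?_
      rw [mulOp_apply, mulOp_apply, phi, dif_neg hj]
    rw [hcomp, hf', phi, dif_neg hj]

/-- The vector is φ^α g; each factor φ_i moves to f through its adjoint and contributes one
eigenvalue. -/
theorem exists_monom_inner (hφ : ∀ j : Fin n, IsMultiplier P m (fun z => phi z j))
    {w : Fin n → ℂ} {f : HardySpace P m}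
    (hf : ∀ j, ContinuousLinearMap.adjoint (mulOp (hφ j)) f = conj (phi w j) • f)
    (α : Fin n →₀ ℕ) (g : HardySpace P m) : ∃ h : HardySpace P m,
      (∀ z : triangle P, h z = monom (phi z) α * g z) ∧
        ⟪h, f⟫_ℂ = conj (monom (phi w) α) * ⟪g, f⟫_ℂ := by
  induction α using Finsupp.induction_linear generalizing g with
  | zero => exact ⟨g, by simp [monom_zero], by simp [monom_zero]⟩
  | add α β ihα ihβ =>
    obtain ⟨k, hk1, hk2⟩ := ihβ g
    obtain ⟨h, hh1, hh2⟩ := ihα k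
    exact ⟨h, fun z => by rw [hh1, hk1, monom_add, mul_assoc],
      by rw [hh2, hk2, monom_add, map_mul, mul_assoc]⟩
  | single i k =>
    induction k with
    | zero => exact ⟨g, by simp [monom_zero], by simp [monom_zero]⟩
    | succ k ih =>
      obtain ⟨h, h1, h2⟩ := ih
      refine ⟨mulOp (hφ i) h, fun z => ?_, ?_⟩
      · rw [mulOp_apply, h1, Finsupp.single_add, monom_add, monom_single_one]
        ring
      · rw [← ContinuousLinearMap.adjoint_inner_right, hf, inner_smul_right, h2,
          Finsupp.single_add, monom_add, monom_single_one, map_mul]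
        ring

theorem coeffMap_of_mem_jointKer (hm : ∀ j, 1 ≤ m j)
    (hM : ∀ j : Fin n, IsMultiplier P m (fun z => z j)) {w : Fin n → ℂ}
    (hw : w ∈ puncturedSpace n) {f : HardySpace P m} (hf : f ∈ jointKer (adjTuple hM) (star w))
    (α : Fin n →₀ ℕ) : coeffMap P m f α =
      √(coeffFun P m α) * conj (monom (phi w) α) * coeffMap P m f 0 := by
  obtain ⟨h, h1, h2⟩ := exists_monom_inner (fun j => isMultiplier_phi P m (hm j))
    (adjoint_mulOp_phi hM _ hw hf) α (basisVec P m 0)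
  have h3 : basisVec P m α = (√(coeffFun P m α) : ℂ) • h := by
    refine RKHS.ext fun z => ?_
    rw [RKHS.coe_smul, Pi.smul_apply, h1, basisVec_apply, basisVec_apply, basisFun, basisFun,
      coeffFun_zero, monom_zero, smul_eq_mul]
    simp
    ring
  rw [← inner_basisVec, h3, inner_smul_left, h2, inner_basisVec, Complex.conj_ofReal, mul_assoc]

/-- All coefficients of f are proportional to the zeroth one, which is thus nonzero by injectivity
of `coeffMap` and can be divided out. -/
theorem summable_of_mem_jointKer (hm : ∀ j, 1 ≤ m j)
    (hM : ∀ j : Fin n, IsMultiplier P m (fun z => z j)) {w : Fin n → ℂ}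
    (hw : w ∈ puncturedSpace n) {f : HardySpace P m} (hf : f ∈ jointKer (adjTuple hM) (star w))
    (h0 : f ≠ 0) : Summable fun α => coeffFun P m α * ‖monom (phi w) α‖ ^ 2 := by
  have hc := coeffMap_of_mem_jointKer hm hM hw hf
  have hne : coeffMap P m f 0 ≠ 0 := fun h => h0 <| by
    have hz : coeffMap P m f = 0 := lp.ext <| funext fun α => by
      rw [hc, h, mul_zero]
      rfl
    exact (coeffMap P m).injective (hz.trans (map_zero _).symm)
  refine (summable_mul_right_iff (pow_ne_zero 2 (norm_ne_zero_iff.mpr hne))).mp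
    ((summable_norm_sq (coeffMap P m f)).congr fun α => ?_)
  rw [hc α, norm_mul, norm_mul, mul_pow, mul_pow, Complex.norm_real, Real.norm_eq_abs, sq_abs,
    Real.sq_sqrt (coeffFun_nonneg P m α), RCLike.norm_conj]

theorem exists_hasSum_of_mem_jointKer (hm : ∀ j, 1 ≤ m j)
    (hM : ∀ j : Fin n, IsMultiplier P m (fun z => z j)) {w : Fin n → ℂ}
    (hw : w ∈ puncturedSpace n) {f : HardySpace P m} (hf : f ∈ jointKer (adjTuple hM) (star w)) :
    ∃ c : ℂ, ∀ z : triangle P,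
      HasSum (fun α => c * (star (basisFun P m α w) * basisFun P m α z)) (f z) := by
  -- The factor conj(w_2 ⋯ w_n) compensates the denominator of conj e_α(w), absent from the
  -- coefficients of f.
  refine ⟨coeffMap P m f 0 * conj (tailProd w), fun z => ?_⟩
  refine (hasSum_coeffMap P m f z).congr_fun fun α => ?_
  have ht : conj (tailProd w) ≠ 0 := by simpa using tailProd_ne_zero hw
  rw [coeffMap_of_mem_jointKer hm hM hw hf α]
  simp only [basisFun, RCLike.star_def, map_div₀, map_mul, Complex.conj_ofReal]
  field_simp

/-- With u = φ(w) ⋄ conj φ(w) ≥ 0, the sums ∑_{k<N} P_j(u)^k are bounded by the value at u of the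
series with coefficients A, uniformly in N; a convergent geometric series has ratio below 1. -/
theorem mem_triangle_of_summable (hm : ∀ j, 1 ≤ m j) {w : Fin n → ℂ} (hw : w ∈ puncturedSpace n)
    (hs : Summable fun α => coeffFun P m α * ‖monom (phi w) α‖ ^ 2) : w ∈ triangle P := by
  refine ⟨hw, fun j => ?_⟩
  set u : Fin n → ℂ := fun i => phi w i * conj (phi w i)
  have hu : ∀ i, 0 ≤ u i := fun i => mul_conj_nonneg _
  have hterm : ∀ α, MvPowerSeries.coeff α (coeffSeries P m) * monom u α =
      ((coeffFun P m α * ‖monom (phi w) α‖ ^ 2 : ℝ) : ℂ) := fun α => by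
    rw [← coe_coeffFun, monom_mul, monom_conj, Complex.mul_conj, Complex.normSq_eq_norm_sq]
    push_cast
    rfl
  have hS : Summable fun α => MvPowerSeries.coeff α (coeffSeries P m) * monom u α := by
    simp only [hterm]
    exact Complex.summable_ofReal.mpr hs
  have habs : HasAbsSum (coeffSeries P m) u _ := ⟨hS.norm, hS.hasSum⟩
  have hpos : 0 ≤ polyVal P j w w := (polyVal_psd P j).diag_nonneg (i := w)
  obtain ⟨hre, him⟩ := Complex.le_def.mp hpos
  refine Complex.lt_def.mpr ⟨?_, by rw [← him]; rfl⟩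
  have hbound : ∀ N, ∑ k ∈ Finset.range N, (polyVal P j w w).re ^ k ≤
      (∑' α, MvPowerSeries.coeff α (coeffSeries P m) * monom u α).re := fun N => by
    have h := eval_le_of_hasAbsSum hu (fun α => (coeff_sum_pow_le P j N α).trans
      (coeff_geomSeries_le P m (hm j) α)) habs
    rw [map_sum] at h
    simp only [map_pow] at h
    refine le_of_eq_of_le ?_ h
    have : MvPolynomial.eval u (P.poly j) = ((polyVal P j w w).re : ℂ) := Complex.ext rfl him.symm
    rw [this]
    norm_cast
  have := summable_of_sum_range_le (fun k => pow_nonneg hre k) hbound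
  simpa [abs_of_nonneg hre] using summable_geometric_iff_norm_lt_one.mp this

theorem star_mem_puncturedSpace {w : Fin n → ℂ} (hw : w ∈ puncturedSpace n) :
    star w ∈ puncturedSpace n := fun j hj => by simpa using hw j hj

/-- φ commutes with conjugation, so φ ⋄ conj φ takes the same value at w and at conj w. This matches
eigenvalues conj w with the unconjugated description of the spectrum. -/
theorem star_mem_triangle {w : Fin n → ℂ} (hw : w ∈ triangle P) : star w ∈ triangle P := by
  refine ⟨star_mem_puncturedSpace hw.1, fun j => ?_⟩
  have h : ∀ i, phi (star w) i = conj (phi w i) := fun i => by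
    unfold phi
    split_ifs <;> simp
  have := hw.2 j
  simp only [polyVal] at this ⊢
  simpa only [h, Complex.conj_conj, mul_comm] using this

end eigenvectors

end

end GenHartogs

/-! ### Point spectrum, joint kernels and series form of the eigenvectors. -/

theorem mainTheorem3 (n : ℕ) (hn : 2 ≤ n) (P : GenHartogs.PosRegTuple n)
    (m : Fin n → ℕ) (hm : ∀ j, 1 ≤ m j) :
    ∃ hM : ∀ j : Fin n, GenHartogs.IsMultiplier P m (fun z => z j),
      GenHartogs.pointSpectrum (GenHartogs.adjTuple hM) ∩ GenHartogs.puncturedSpace n =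
          GenHartogs.triangle P ∧
      (∀ w : GenHartogs.triangle P,
        GenHartogs.jointKer (GenHartogs.adjTuple hM) (star (w : Fin n → ℂ)) =
          Submodule.span ℂ {GenHartogs.kernelFun P m w}) ∧
      (∀ w ∈ GenHartogs.puncturedSpace n,
        ∀ f ∈ GenHartogs.jointKer (GenHartogs.adjTuple hM) (star w),
          (∃ c : ℂ, ∀ z : GenHartogs.triangle P,
            HasSum (fun α : Fin n →₀ ℕ =>
              c * (star (GenHartogs.basisFun P m α w) * GenHartogs.basisFun P m α z)) (f z)) ∧
          (f ≠ 0 →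
            Summable (fun α : Fin n →₀ ℕ =>
              GenHartogs.coeffFun P m α * ‖GenHartogs.monom (GenHartogs.phi w) α‖ ^ 2))) := by
  have hM := GenHartogs.isMultiplier_coord P m hm
  refine ⟨hM, Set.Subset.antisymm ?_ ?_, fun w => le_antisymm ?_ ?_, fun w hw f hf =>
    ⟨GenHartogs.exists_hasSum_of_mem_jointKer hm hM hw hf,
      GenHartogs.summable_of_mem_jointKer hm hM hw hf⟩⟩
  · rintro w ⟨hspec, hw⟩
    obtain ⟨f, hf, h0⟩ := Submodule.exists_mem_ne_zero_of_ne_bot hspec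
    have hw' := GenHartogs.star_mem_puncturedSpace hw
    rw [← star_star w] at hf
    have := GenHartogs.mem_triangle_of_summable hm hw'
      (GenHartogs.summable_of_mem_jointKer hm hM hw' hf h0)
    simpa using GenHartogs.star_mem_triangle this
  · intro w hw
    have hk := GenHartogs.kernelFun_mem_jointKer hM ⟨star w, GenHartogs.star_mem_triangle hw⟩
    rw [star_star] at hk
    exact ⟨fun h => GenHartogs.kernelFun_ne_zero _ ((Submodule.eq_bot_iff _).mp h _ hk), hw.1⟩
  · intro f hf
    obtain ⟨c, hc⟩ := GenHartogs.exists_hasSum_of_mem_jointKer hm hM w.2.1 hf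
    refine Submodule.mem_span_singleton.mpr ⟨c, RKHS.ext fun z => ?_⟩
    rw [RKHS.coe_smul, Pi.smul_apply, GenHartogs.kernelFun_apply, smul_eq_mul]
    refine HasSum.unique ?_ (hc z)
    simpa only [mul_comm, RCLike.star_def] using
      (GenHartogs.hasSum_basisFun_mul_conj P m z.2 w.2).mul_left c
  · rw [Submodule.span_singleton_le_iff_mem]
    exact GenHartogs.kernelFun_mem_jointKer hM w
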